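/- Let $p$ be a prime, $r,m\ge 1$ integers with $r\mid m$, and let $q=p^r$, $n=p^m-1$, $K=\mathbb F_q\subseteq G=\mathbb F_{p^m}$, and let $\beta\in G$ be a primitive $n$-th root of unity. For a divisor $g$ of $x^n-1$ in $K[x]$, the cyclic code $C$ of length $n$ generated by $g$ is the ideal generated by $g$ in $K[x]/(x^n-1)$; its defining set is $T=\{0\le i<n : g(\beta^i)=0\}$. It is called maximal if $T$ is a single cyclotomic class $\{jq^l \bmod n : l\ge 0\}$. The extended code is $$\widehat C=\Big\{x\in K^G : (x_{\beta^0},x_{\beta^1},\dots,x_{\beta^{n-1}})\in C,\ x_0=-\sum_{i=0}^{n-1}x_{\beta^i}\Big\},$$ a linear code of length $p^m$ whose coordinates are labelled by the elements of $G$. It is affine-invariant if every permutation $u\mapsto au+b$ ($a\in G^*$, $b\in G$) of the coordinates leaves it invariant. An extended maximal affine-invariant code is an affine-invariant code $\widehat C$ with $C$ maximal. An $[[N,k,d]]_q$ quantum code is a subspace of $(\mathbb C^q)^{\otimes N}$ of dimension $q^k$ with minimum distance exactly $d$, i.e. $d$ is the largest integer such that all errors acting on fewer than $d$ of the $N$ tensor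 factors are detected; by the usual convention, a code of dimension $1$ (i.e. $k=0$) is moreover required to be pure for these errors. For linear codes $C_2^\perp\subseteq C_1\subseteq K^N$ the CSS construction gives the quantum code spanned by the states $\sum_{y\in C_2^\perp}|x+y\rangle$, $x\in C_1$. **Theorem.** Suppose that $p>3$ or $m>2$ or $r\ne 1$. Then extended maximal affine-invariant codes exist, and every such code $A\subseteq K^G$ contains its Euclidean dual $A^\perp$. If $d_A$ is the minimum distance of $A$, then the CSS construction applied to $C_1=C_2=A$ gives a quantum code with parameters $$\Big[\Big[p^m,\ p^m-2-2\tfrac mr,\ d_Q\Big]\Big]_q,\qquad \tfrac mr+2\ \ge\ d_Q\ \ge\ d_A .$$ -/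

import Mathlib

open Polynomial

namespace AffineCode

noncomputable section

/-! ### Cyclic codes and extended cyclic codes -/

/-- The algebra `K[x] / (x ^ n - 1)`. -/
abbrev CyclicAlgebra (K : Type*) [Field K] (n : ℕ) : Type _ :=
  K[X] ⧸ Ideal.span {(X ^ n - 1 : K[X])}

/-- The class of `c₀ + c₁ x + ⋯ + c_{n-1} x ^ (n-1)` in `K[x] / (x ^ n - 1)`. -/
def wordClass {K : Type*} [Field K] {n : ℕ} (c : Fin n → K) : CyclicAlgebra K n :=
  Ideal.Quotient.mk _ (∑ i : Fin n, C (c i) * X ^ (i : ℕ))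

/-- The cyclic code of length `n` generated by `g`: the words whose class lies in the ideal of
`K[x] / (x ^ n - 1)` generated by the class of `g`. -/
def cyclicCode {K : Type*} [Field K] (n : ℕ) (g : K[X]) : Submodule K (Fin n → K) where
  carrier := {c | wordClass c ∈ Ideal.span {(Ideal.Quotient.mk _ g : CyclicAlgebra K n)}}
  zero_mem' := by simp [wordClass]
  add_mem' := by
    intro a b ha hb
    have h : wordClass (a + b) = wordClass a + wordClass b := by
      simp [wordClass, add_mul, Finset.sum_add_distrib]
    simp only [Set.mem_ofPred_eq] at ha hb ⊢
    rw [h]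
    exact Ideal.add_mem _ ha hb
  smul_mem' := by
    intro k a ha
    have h : wordClass (k • a) = Ideal.Quotient.mk _ (C k) * wordClass a := by
      simp only [wordClass, ← map_mul, Finset.mul_sum]
      simp [mul_assoc]
    simp only [Set.mem_ofPred_eq] at ha ⊢
    rw [h]
    exact Ideal.mul_mem_left _ _ ha

/-- The defining set `{0 ≤ i < n | g(β ^ i) = 0}` of the cyclic code generated by `g`. -/
def definingSet {K G : Type*} [Field K] [Field G] [Algebra K G] (n : ℕ) (β : G) (g : K[X]) :
    Set ℕ :=
  {i | i < n ∧ aeval (β ^ i) g = 0}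

/-- The `q`-cyclotomic class of `j` modulo `n`, inside `{0, …, n - 1}`. -/
def cyclotomicClass (q n j : ℕ) : Set ℕ :=
  {i | i < n ∧ ∃ l : ℕ, i ≡ j * q ^ l [MOD n]}

/-- The extended code of the cyclic code of length `n` generated by `g`. Coordinates are labelled
by the elements of `G`: coordinate `i` of the cyclic code has the label `β ^ i`, and the
additional (parity check) coordinate has the label `0`. -/
def extendedCode {K G : Type*} [Field K] [Field G] (n : ℕ) (β : G) (g : K[X]) :
    Submodule K (G → K) where
  carrier := {x | (fun i : Fin n => x (β ^ (i : ℕ))) ∈ cyclicCode n g ∧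
    x 0 = -∑ i : Fin n, x (β ^ (i : ℕ))}
  zero_mem' := ⟨(cyclicCode n g).zero_mem, by simp⟩
  add_mem' := by
    intro a b ha hb
    refine ⟨(cyclicCode n g).add_mem ha.1 hb.1, ?_⟩
    simp only [Pi.add_apply, Finset.sum_add_distrib, ha.2, hb.2]
    ring
  smul_mem' := by
    intro k a ha
    refine ⟨(cyclicCode n g).smul_mem k ha.1, ?_⟩
    simp only [Pi.smul_apply, smul_eq_mul, ← Finset.mul_sum, ha.2]
    ring

/-! ### Linear codes: permutation group, dual, minimum distance -/

/-- The permutation group of a linear code: the coordinate permutations leaving it invariant. -/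
def permGroup {K ι : Type*} [Field K] (A : Submodule K (ι → K)) : Subgroup (Equiv.Perm ι) where
  carrier := {σ | ∀ x : ι → K, x ∘ σ ∈ A ↔ x ∈ A}
  one_mem' := fun _ => Iff.rfl
  mul_mem' := by
    intro σ τ hσ hτ x
    exact (hτ (x ∘ σ)).trans (hσ x)
  inv_mem' := by
    intro σ hσ x
    have h := hσ (x ∘ (σ⁻¹ : Equiv.Perm ι))
    have e : (x ∘ (σ⁻¹ : Equiv.Perm ι)) ∘ σ = x := by
      funext i
      simp
    rw [e] at h
    exact h.symm

/-- The permutations `g ↦ a g + b`, `a ≠ 0`, of the field `G`. -/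
def affineGroup (G : Type*) [Field G] : Set (Equiv.Perm G) :=
  {σ | ∃ a b : G, a ≠ 0 ∧ ∀ g, σ g = a * g + b}

/-- `A` is affine-invariant: its permutation group contains all affine permutations of `G`. -/
def IsAffineInvariant {K G : Type*} [Field K] [Field G] (A : Submodule K (G → K)) : Prop :=
  affineGroup G ⊆ (permGroup A : Set (Equiv.Perm G))

/-- `A` is an extended maximal affine-invariant code: it is affine-invariant, and it is the
extended code of a cyclic code of length `n` whose defining set is a single cyclotomic class. -/
def IsExtendedMaximalAffineInvariant {K G : Type*} [Field K] [Fintype K] [Field G] [Algebra K G]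
    (n : ℕ) (β : G) (A : Submodule K (G → K)) : Prop :=
  (∃ g : K[X], g ∣ X ^ n - 1 ∧
    (∃ j < n, definingSet n β g = cyclotomicClass (Fintype.card K) n j) ∧
    A = extendedCode n β g) ∧
  IsAffineInvariant A

/-- The (Euclidean) dual code. -/
def dualCode {K ι : Type*} [Field K] [Fintype ι] (A : Submodule K (ι → K)) :
    Submodule K (ι → K) where
  carrier := {y | ∀ x ∈ A, x ⬝ᵥ y = 0}
  zero_mem' := by
    intro x _
    simp
  add_mem' := by
    intro a b ha hb x hx
    rw [dotProduct_add, ha x hx, hb x hx, add_zero]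
  smul_mem' := by
    intro k a ha x hx
    rw [dotProduct_smul, ha x hx, smul_zero]

/-- `d` is the minimum distance of the linear code `A`: the least weight of a nonzero codeword. -/
def HasMinDist {K ι : Type*} [Field K] [DecidableEq K] [Fintype ι] (A : Submodule K (ι → K))
    (d : ℕ) : Prop :=
  IsLeast {w | ∃ x ∈ A, x ≠ 0 ∧ hammingNorm x = w} d

/-! ### Quantum codes -/

/-- The state space `(ℂ ^ q)^{⊗ n}` of `n` qudits: the qudits are labelled by `ι` (so `n = |ι|`),
the levels of each by `K` (so `q = |K|`), with orthonormal basis `|x⟩`, `x ∈ K ^ ι`. -/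
abbrev StateSpace (K ι : Type*) : Type _ := EuclideanSpace ℂ (ι → K)

/-- The operator `E` (a matrix in the basis `|x⟩`) acts only on the qudits in `S`:
`E = e ⊗ id` with `e` an arbitrary operator on the qudits in `S`. -/
def ActsOn {K ι : Type*} [DecidableEq K] [Fintype ι] [DecidableEq ι] (S : Finset ι)
    (E : Matrix (ι → K) (ι → K) ℂ) : Prop :=
  ∃ e : Matrix (S → K) (S → K) ℂ, ∀ x y : ι → K,
    E x y = if ∀ i, i ∉ S → x i = y i then e (fun i => x i) (fun i => y i) else 0

/-- The code `Q` detects the error `E`: with `P` the orthogonal projection onto `Q`,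
`P E P` is a multiple of `P`. -/
def Detects {K ι : Type*} [Fintype K] [DecidableEq K] [Fintype ι] [DecidableEq ι]
    (Q : Submodule ℂ (StateSpace K ι)) (E : Matrix (ι → K) (ι → K) ℂ) : Prop :=
  ∃ c : ℂ, ∀ u ∈ Q, ∀ v ∈ Q, inner ℂ u (Matrix.toEuclideanLin E v) = c * inner ℂ u v

/-- The code `Q` is pure for the error `E`: `P E P = (tr E / q ^ n) P`, so that traceless errors
map `Q` to its orthogonal complement. -/
def IsPureFor {K ι : Type*} [Fintype K] [DecidableEq K] [Fintype ι] [DecidableEq ι]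
    (Q : Submodule ℂ (StateSpace K ι)) (E : Matrix (ι → K) (ι → K) ℂ) : Prop :=
  ∀ u ∈ Q, ∀ v ∈ Q, inner ℂ u (Matrix.toEuclideanLin E v) =
    E.trace / (Fintype.card (ι → K) : ℂ) * inner ℂ u v

/-- All errors on fewer than `d` qudits are detected by `Q`. For a one-dimensional code, where
detection is no condition, the usual convention is in force: the code has to be pure for them. -/
def DetectsBelow {K ι : Type*} [Fintype K] [DecidableEq K] [Fintype ι] [DecidableEq ι]
    (Q : Submodule ℂ (StateSpace K ι)) (d : ℕ) : Prop :=
  ∀ S : Finset ι, S.card < d → ∀ E : Matrix (ι → K) (ι → K) ℂ, ActsOn S E →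
    Detects Q E ∧ (Module.finrank ℂ Q = 1 → IsPureFor Q E)

/-- `Q` is an `[[n, k, d]]_q` quantum code, `n = |ι|`, `q = |K|`: a subspace of `(ℂ ^ q)^{⊗ n}` of
dimension `q ^ k` with minimum distance (exactly) `d`. -/
def IsQuantumCode {K ι : Type*} [Fintype K] [DecidableEq K] [Fintype ι] [DecidableEq ι]
    (Q : Submodule ℂ (StateSpace K ι)) (k d : ℕ) : Prop :=
  Module.finrank ℂ Q = Fintype.card K ^ k ∧ IsGreatest {d' | DetectsBelow Q d'} d

/-- The (unnormalized) coset state `∑_{y ∈ D} |x + y⟩`. -/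
def cosetState {K ι : Type*} [Field K] (D : Submodule K (ι → K)) (x : ι → K) : StateSpace K ι :=
  WithLp.toLp 2 (Set.indicator {z | z - x ∈ D} 1)

/-- The CSS code of linear codes `C₁`, `C₂` (with `C₂^⊥ ⊆ C₁`): the span of the states
`∑_{y ∈ C₂^⊥} |x + y⟩`, `x ∈ C₁`. -/
def cssCode {K ι : Type*} [Field K] [Fintype ι] (C₁ C₂ : Submodule K (ι → K)) :
    Submodule ℂ (StateSpace K ι) :=
  Submodule.span ℂ (cosetState (dualCode C₂) '' (C₁ : Set (ι → K)))

end

end AffineCode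

namespace AffineCode

/-! ### Euclidean duality of linear codes. -/

section Dual

variable {K ι : Type*} [Field K] [Fintype ι]

/-! Write M = m/r. Every code A in question consists of the words x with ∑ x_u = 0 and ∑ x_u u^(p^s)
= 0 for some s. To see this, let j represent the defining class T, with j ≠ 0, and let p^s be the
exact power of p dividing j. If p^s were not in T, all words u ↦ Tr(c u^(n - p^s)) would lie in A.
Translation invariance then gives ∑ u^(n - p^s) (u + 1)^j = 0. But this sum is -(j choose p^s), a
unit mod p by Lucas (`exists_prime_pow_mem_cyclotomicClass`). The class of 0 is not translation
invariant. The remaining exponents in T are q-power conjugates of p^s and impose nothing new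
(`extendedCode_eq_parityCode`).

After relabelling by a Frobenius power, A^⊥ is the (M + 1)-dimensional space of affine functions G →
K. A product of two of these has degree at most 2 < (q - 1)M, so its values sum to zero. Thus A^⊥ ⊆
A (`affineWords_le_parityCode`).

The CSS code is pure below d_A (`isPureFor_cssCode`), which is the lower bound on d_Q. For the upper
bound, any M + 2 vectors (1, u) in K × G are dependent, so A has a nonzero word w of weight at most
M + 2. Its support can be chosen so that w ∉ A^⊥ unless A = A^⊥; the shift by w then violates
detection or, in dimension one, purity. -/

theorem mem_dualCode {A : Submodule K (ι → K)} {y : ι → K} :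
    y ∈ dualCode A ↔ ∀ x ∈ A, x ⬝ᵥ y = 0 := Iff.rfl

theorem dotProductBilin_isRefl : (dotProductBilin K K : LinearMap.BilinForm K (ι → K)).IsRefl :=
  fun x y h => by
    simpa [dotProduct_comm] using h

theorem dotProductBilin_nondegenerate :
    (dotProductBilin K K : LinearMap.BilinForm K (ι → K)).Nondegenerate := by
  classical
  rw [dotProductBilin_isRefl.nondegenerate_iff_separatingLeft]
  intro x hx
  funext i
  simpa using hx (Pi.single i 1)

theorem dualCode_eq_orthogonal (A : Submodule K (ι → K)) :
    dualCode A =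
      LinearMap.BilinForm.orthogonal (dotProductBilin K K : LinearMap.BilinForm K (ι → K)) A := by
  ext y
  rfl

theorem finrank_add_finrank_dualCode (A : Submodule K (ι → K)) :
    Module.finrank K A + Module.finrank K (dualCode A) = Fintype.card ι := by
  have h := Submodule.finrank_le A
  rw [dualCode_eq_orthogonal, LinearMap.BilinForm.finrank_orthogonal dotProductBilin_nondegenerate]
  rw [Module.finrank_fintype_fun_eq_card] at h ⊢
  omega

theorem dualCode_dualCode (A : Submodule K (ι → K)) : dualCode (dualCode A) = A := by
  rw [dualCode_eq_orthogonal, dualCode_eq_orthogonal,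
    LinearMap.BilinForm.orthogonal_orthogonal (B := dotProductBilin K K)
      dotProductBilin_nondegenerate dotProductBilin_isRefl]

theorem exists_hasMinDist [DecidableEq K] {A : Submodule K (ι → K)} (hA : A ≠ ⊥) :
    ∃ d, HasMinDist A d := by
  obtain ⟨x, hx, hx0⟩ := Submodule.exists_mem_ne_zero_of_ne_bot hA
  have hne : {w | ∃ x ∈ A, x ≠ 0 ∧ hammingNorm x = w}.Nonempty := ⟨_, x, hx, hx0, rfl⟩
  exact ⟨_, Nat.sInf_mem hne, fun _ h => Nat.sInf_le h⟩

/-- On fewer coordinates than the minimum distance of the dual code, the words of a code take all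
values. -/
theorem exists_mem_dualCode_eq_on [DecidableEq K] [DecidableEq ι] {A : Submodule K (ι → K)} {d : ℕ}
    (hd : HasMinDist A d) {S : Finset ι} (hS : S.card < d) (v : ι → K) :
    ∃ y ∈ dualCode A, ∀ i ∈ S, y i = v i := by
  let ρ : (ι → K) →ₗ[K] (S → K) := LinearMap.funLeft K K (fun i : S => (i : ι))
  have key : (dualCode A).map ρ = ⊤ := by
    -- A vector orthogonal to the restriction of A^⊥ to S extends by zero to a word of A^⊥⊥ = A of
    -- weight below d, hence vanishes.
    rw [← dualCode_dualCode ((dualCode A).map ρ)]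
    suffices h : dualCode ((dualCode A).map ρ) = ⊥ by
      rw [h, eq_top_iff]
      intro w _ x hx
      rw [(Submodule.mem_bot K).1 hx, zero_dotProduct]
    rw [eq_bot_iff]
    intro w hw
    let x : ι → K := fun i => if h : i ∈ S then w ⟨i, h⟩ else 0
    have hxA : x ∈ A := by
      rw [← dualCode_dualCode A]
      intro y hy
      rw [← hw (ρ y) (Submodule.mem_map_of_mem hy)]
      simp only [dotProduct]
      rw [← Finset.sum_subset S.subset_univ, ← Finset.sum_coe_sort]
      · refine Finset.sum_congr rfl fun i _ => ?_
        simp [x, ρ, LinearMap.funLeft_apply]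
      · intro i _ hi
        simp [x, hi]
    by_contra hw0
    have hx0 : x ≠ 0 := by
      intro h0
      apply hw0
      rw [Submodule.mem_bot]
      funext i
      simpa [x] using congrFun h0 i
    have h1 := hd.2 ⟨x, hxA, hx0, rfl⟩
    have h2 : hammingNorm x ≤ S.card := by
      refine Finset.card_le_card fun i hi => ?_
      by_contra hiS
      simp [x, hiS] at hi
    omega
  have : ρ v ∈ (dualCode A).map ρ := by rw [key]; trivial
  obtain ⟨y, hy, hyv⟩ := this
  exact ⟨y, hy, fun i hi => congrFun hyv ⟨i, hi⟩⟩

end Dual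

/-! ### Coset states and the dimension of a CSS code. -/

section CosetState

variable {K ι : Type*} [Field K]

theorem cosetState_apply (D : Submodule K (ι → K)) (x z : ι → K) [Decidable (z - x ∈ D)] :
    cosetState D x z = if z - x ∈ D then 1 else 0 := by
  by_cases h : z - x ∈ D <;> simp [cosetState, h]

theorem cosetState_ne_zero (D : Submodule K (ι → K)) (x : ι → K) : cosetState D x ≠ 0 := by
  classical
  intro h
  have := congrArg (fun v : StateSpace K ι => v x) h
  simp [cosetState_apply] at this

theorem cosetState_eq_of_sub_mem {D : Submodule K (ι → K)} {x y : ι → K} (h : x - y ∈ D) :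
    cosetState D x = cosetState D y := by
  classical
  ext z
  rw [cosetState_apply, cosetState_apply]
  congr 1
  rw [← D.add_mem_iff_left h (x := z - x), sub_add_sub_cancel]

variable [Fintype K] [Fintype ι] [DecidableEq ι]

open Classical in
theorem inner_cosetState (D : Submodule K (ι → K)) (x y : ι → K) :
    (inner ℂ (cosetState D x) (cosetState D y) : ℂ) =
      ∑ z, if z - x ∈ D ∧ z - y ∈ D then 1 else 0 := by
  rw [PiLp.inner_apply]
  refine Finset.sum_congr rfl fun z _ => ?_
  rw [cosetState_apply, cosetState_apply]
  by_cases h : z - x ∈ D <;> by_cases h' : z - y ∈ D <;> simp [h, h']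

theorem inner_cosetState_of_sub_notMem {D : Submodule K (ι → K)} {x y : ι → K} (h : x - y ∉ D) :
    (inner ℂ (cosetState D x) (cosetState D y) : ℂ) = 0 := by
  classical
  rw [inner_cosetState]
  refine Finset.sum_eq_zero fun z _ => if_neg ?_
  rintro ⟨h1, h2⟩
  exact h (by simpa using D.sub_mem h2 h1)

/-- States of distinct cosets have disjoint supports, so one state per class of C₁ / C₂^⊥ gives an
orthogonal basis. -/
theorem finrank_cssCode {C₁ C₂ : Submodule K (ι → K)} (h : dualCode C₂ ≤ C₁) :
    Module.finrank ℂ (cssCode C₁ C₂) =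
      Fintype.card K ^ (Module.finrank K C₁ - Module.finrank K (dualCode C₂)) := by
  classical
  set D := dualCode C₂
  let R := C₁ ⧸ D.submoduleOf C₁
  let v : R → StateSpace K ι := fun a => cosetState D (a.out : C₁)
  have hv : LinearIndependent ℂ v := by
    refine linearIndependent_of_ne_zero_of_inner_eq_zero (fun a => cosetState_ne_zero _ _) ?_
    intro a b hab
    refine inner_cosetState_of_sub_notMem fun hm => hab ?_
    have : (a.out - b.out : C₁) ∈ D.submoduleOf C₁ := hm
    have h2 := (Submodule.Quotient.eq (D.submoduleOf C₁)).2 this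
    rwa [← Submodule.Quotient.mk_out a, ← Submodule.Quotient.mk_out b]
  have hr : Set.range v = cosetState D '' (C₁ : Set (ι → K)) := by
    ext s
    constructor
    · rintro ⟨a, rfl⟩
      exact ⟨_, a.out.2, rfl⟩
    · rintro ⟨x, hx, rfl⟩
      refine ⟨Submodule.Quotient.mk ⟨x, hx⟩, cosetState_eq_of_sub_mem ?_⟩
      exact (Submodule.Quotient.eq (D.submoduleOf C₁)).1
        (Submodule.Quotient.mk_out (Submodule.Quotient.mk ⟨x, hx⟩ : R))
  have : Fintype R := Fintype.ofFinite R
  rw [cssCode, ← hr, finrank_span_eq_card hv, Module.card_eq_pow_finrank (K := K) (V := R),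
    Submodule.finrank_quotient, (Submodule.submoduleOfEquivOfLe h).finrank_eq]

end CosetState

/-! ### Shift errors. -/

section ShiftError

variable {K ι : Type*} [Field K] [DecidableEq K] [Fintype ι] [DecidableEq ι]

/-- The operator `|x⟩ ↦ |x + w⟩`. -/
def shiftError (w : ι → K) : Matrix (ι → K) (ι → K) ℂ := fun x y => if x = y + w then 1 else 0

theorem actsOn_shiftError {w : ι → K} {S : Finset ι} (hw : ∀ i ∉ S, w i = 0) :
    ActsOn S (shiftError w) := by
  refine ⟨fun a b => if ∀ i : S, a i = b i + w i then 1 else 0, fun x y => ?_⟩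
  by_cases h : ∀ i, i ∉ S → x i = y i
  · rw [if_pos h]
    refine if_congr ?_ rfl rfl
    constructor
    · rintro rfl i
      rfl
    · intro hS
      funext i
      by_cases hi : i ∈ S
      · exact hS ⟨i, hi⟩
      · simp [h i hi, hw i hi]
  · rw [if_neg h, shiftError, if_neg]
    rintro rfl
    exact h fun i hi => by simp [hw i hi]

end ShiftError

/-! ### Purity and minimum distance of CSS codes. -/

section Quantum

variable {K ι : Type*} [Field K] [Fintype K] [DecidableEq K] [Fintype ι] [DecidableEq ι]

open Classical in
theorem inner_cosetState_toEuclideanLin (D : Submodule K (ι → K)) (x y : ι → K)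
    (E : Matrix (ι → K) (ι → K) ℂ) :
    inner ℂ (cosetState D x) (Matrix.toEuclideanLin E (cosetState D y)) =
      ∑ z, ∑ z', if z - x ∈ D ∧ z' - y ∈ D then E z z' else 0 := by
  rw [PiLp.inner_apply]
  refine Finset.sum_congr rfl fun z _ => ?_
  rw [cosetState_apply, Matrix.toLpLin_apply]
  by_cases h : z - x ∈ D
  · simp [h, Matrix.mulVec, dotProduct, cosetState_apply, -WithLp.ofLp_sum]
  · simp [h]

/-- The CSS code of a dual-containing code of minimum distance `d` is pure for all errors on fewer
than `d` qudits. -/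
theorem isPureFor_cssCode {A : Submodule K (ι → K)} (hA : dualCode A ≤ A) {d : ℕ}
    (hd : HasMinDist A d) {S : Finset ι} (hS : S.card < d) {E : Matrix (ι → K) (ι → K) ℂ}
    (hE : ActsOn S E) : IsPureFor (cssCode A A) E := by
  classical
  obtain ⟨e, he⟩ := hE
  set D := dualCode A
  -- Matrix entries of E vanish unless the two words agree off S; two words of A that close must
  -- coincide.
  have diag : ∀ x ∈ A, ∀ y ∈ A, ∀ z z', z - x ∈ D → z' - y ∈ D → E z z' ≠ 0 → z = z' := by
    intro x hx y hy z z' hz hz' hE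
    by_contra hne
    have hzA : z - z' ∈ A := by
      have := A.add_mem (A.sub_mem (hA hz) (hA hz')) (A.sub_mem hx hy)
      have e : z - x - (z' - y) + (x - y) = z - z' := by abel
      rwa [e] at this
    have h1 := hd.2 ⟨_, hzA, sub_ne_zero.2 hne, rfl⟩
    have h2 : hammingNorm (z - z') ≤ S.card := by
      refine Finset.card_le_card fun i hi => ?_
      by_contra hiS
      rw [he] at hE
      have hz : ∀ i, i ∉ S → z i = z' i := by
        by_contra hcon
        rw [if_neg hcon] at hE
        exact hE rfl
      simp [hz i hiS] at hi
    omega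
  have diagE : ∀ z z' : ι → K, (∀ i ∈ S, z i = z' i) → E z z = E z' z' := by
    intro z z' h
    rw [he, he, if_pos fun _ _ => rfl, if_pos fun _ _ => rfl]
    have : (fun i : S => z i) = fun i : S => z' i := funext fun i => h i i.2
    rw [this]
  -- Diagonal entries depend only on the coordinates in S, where words of D take arbitrary values.
  -- The sum over a coset is therefore unchanged under any shift v; averaging over v produces the
  -- trace.
  have avg : ∀ x : ι → K, (Fintype.card (ι → K) : ℂ) * ∑ z, (if z - x ∈ D then E z z else 0) =
      E.trace * ∑ z, (if z - x ∈ D then 1 else 0) := by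
    intro x
    have h1 : ∀ v : ι → K, ∑ z, (if z - x ∈ D then E z z else 0) =
        ∑ z, (if z - x ∈ D then E (z + v) (z + v) else 0) := by
      intro v
      obtain ⟨y, hy, hyv⟩ := exists_mem_dualCode_eq_on hd hS v
      rw [← Equiv.sum_comp (Equiv.addRight y)]
      refine Finset.sum_congr rfl fun z _ => ?_
      simp only [Equiv.coe_addRight]
      have e : z + y - x ∈ D ↔ z - x ∈ D := by
        rw [add_sub_right_comm]
        exact D.add_mem_iff_left hy
      simp only [e]
      split_ifs
      · exact diagE _ _ fun i hi => by simp [hyv i hi]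
      · rfl
    calc (Fintype.card (ι → K) : ℂ) * ∑ z, (if z - x ∈ D then E z z else 0)
        = ∑ v : ι → K, ∑ z, (if z - x ∈ D then E (z + v) (z + v) else 0) := by
          rw [← Finset.sum_congr rfl fun v _ => h1 v, Finset.sum_const, Finset.card_univ,
            nsmul_eq_mul]
      _ = ∑ z, (if z - x ∈ D then E.trace else 0) := by
          rw [Finset.sum_comm]
          refine Finset.sum_congr rfl fun z _ => ?_
          split_ifs
          · exact Equiv.sum_comp (Equiv.addLeft z) fun y => E y y
          · simp
      _ = _ := by
          rw [Finset.mul_sum]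
          exact Finset.sum_congr rfl fun z _ => by split_ifs <;> simp
  have hcard : (Fintype.card (ι → K) : ℂ) ≠ 0 := Nat.cast_ne_zero.2 Fintype.card_ne_zero
  intro u hu v hv
  induction hu using Submodule.span_induction with
  | zero => simp
  | add a b _ _ ha hb => rw [inner_add_left, inner_add_left, ha, hb]; ring
  | smul c a _ ha => rw [inner_smul_left, inner_smul_left, ha]; ring
  | mem u hu =>
    induction hv using Submodule.span_induction with
    | zero => simp
    | add a b _ _ ha hb => rw [map_add, inner_add_right, inner_add_right, ha, hb]; ring
    | smul c a _ ha => rw [map_smul, inner_smul_right, inner_smul_right, ha]; ring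
    | mem v hv =>
      obtain ⟨x, hx, rfl⟩ := hu
      obtain ⟨y, hy, rfl⟩ := hv
      rw [inner_cosetState_toEuclideanLin]
      have hsum : ∀ z, (∑ z', if z - x ∈ D ∧ z' - y ∈ D then E z z' else 0) =
          if z - x ∈ D ∧ z - y ∈ D then E z z else 0 := by
        intro z
        refine Finset.sum_eq_single z (fun z' _ hne => ?_) (by simp)
        split_ifs with h
        · by_contra h0
          exact hne (diag x hx y hy z z' h.1 h.2 h0).symm
        · rfl
      rw [Finset.sum_congr rfl fun z _ => hsum z]
      by_cases hxy : x - y ∈ D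
      · rw [← cosetState_eq_of_sub_mem hxy, inner_cosetState]
        have e : ∀ z, (z - x ∈ D ∧ z - y ∈ D) ↔ z - x ∈ D := fun z => by
          rw [and_iff_left_of_imp]
          intro h
          simpa using D.add_mem h hxy
        simp only [e, and_self]
        have := avg x
        field_simp
        linear_combination this
      · rw [inner_cosetState_of_sub_notMem hxy, mul_zero]
        refine Finset.sum_eq_zero fun z _ => if_neg ?_
        rintro ⟨h1, h2⟩
        exact hxy (by simpa using D.sub_mem h2 h1)

theorem toEuclideanLin_shiftError_cosetState (D : Submodule K (ι → K)) (w x : ι → K) :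
    Matrix.toEuclideanLin (shiftError w) (cosetState D x) = cosetState D (x + w) := by
  classical
  ext z
  rw [cosetState_apply, Matrix.toLpLin_apply]
  simp only [Matrix.mulVec, dotProduct, shiftError, cosetState_apply]
  rw [Finset.sum_eq_single (z - w)]
  · simp [sub_sub, add_comm]
  · intro b _ hb
    rw [if_neg, zero_mul]
    rintro rfl
    simp at hb
  · simp

theorem trace_shiftError {w : ι → K} (hw : w ≠ 0) : (shiftError w).trace = 0 := by
  refine Finset.sum_eq_zero fun x _ => if_neg ?_
  simpa using hw

/-- The shift carries the state of the coset of 0 to the orthogonal state of the coset of w; both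
lie in the code. -/
theorem not_detects_shiftError {C₁ C₂ : Submodule K (ι → K)} {w : ι → K} (hw : w ∈ C₁)
    (hw' : w ∉ dualCode C₂) : ¬ Detects (cssCode C₁ C₂) (shiftError w) := by
  rintro ⟨c, hc⟩
  have h0 : cosetState (dualCode C₂) 0 ∈ cssCode C₁ C₂ :=
    Submodule.subset_span ⟨0, C₁.zero_mem, rfl⟩
  have h1 : cosetState (dualCode C₂) w ∈ cssCode C₁ C₂ := Submodule.subset_span ⟨w, hw, rfl⟩
  have h := hc _ h1 _ h0
  rw [toEuclideanLin_shiftError_cosetState, zero_add,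
    inner_cosetState_of_sub_notMem (x := w) (y := 0) (by simpa using hw'), mul_zero] at h
  exact cosetState_ne_zero _ _ (inner_self_eq_zero.1 h)

/-- The shift is traceless yet fixes the state of the coset of 0. -/
theorem not_isPureFor_shiftError {C₁ C₂ : Submodule K (ι → K)} {w : ι → K} (hw0 : w ≠ 0)
    (hw : w ∈ dualCode C₂) : ¬ IsPureFor (cssCode C₁ C₂) (shiftError w) := by
  intro hc
  have h0 : cosetState (dualCode C₂) 0 ∈ cssCode C₁ C₂ :=
    Submodule.subset_span ⟨0, C₁.zero_mem, rfl⟩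
  have h := hc _ h0 _ h0
  rw [toEuclideanLin_shiftError_cosetState, zero_add, trace_shiftError hw0, zero_div, zero_mul,
    cosetState_eq_of_sub_mem (x := w) (y := 0) (by simpa using hw)] at h
  exact cosetState_ne_zero _ _ (inner_self_eq_zero.1 h)

/-- The last clause on w covers degenerate errors: a shift by a word of A^⊥ acts trivially and is
excluded only by purity, which is required only in dimension one, that is, when A = A^⊥. -/
theorem isQuantumCode_cssCode {A : Submodule K (ι → K)} (hA : dualCode A ≤ A) {d b : ℕ}
    (hd : HasMinDist A d)
    (hb : ∃ w ∈ A, w ≠ 0 ∧ hammingNorm w ≤ b ∧ (w ∈ dualCode A → A = dualCode A)) :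
    ∃ dQ, IsQuantumCode (cssCode A A) (Module.finrank K A - Module.finrank K (dualCode A)) dQ ∧
      d ≤ dQ ∧ dQ ≤ b := by
  have hmem : DetectsBelow (cssCode A A) d := fun S hS E hE =>
    have h := isPureFor_cssCode hA hd hS hE
    ⟨⟨_, h⟩, fun _ => h⟩
  have hbound : ∀ d', DetectsBelow (cssCode A A) d' → d' ≤ b := by
    intro d' hd'
    by_contra hlt
    obtain ⟨w, hw, hw0, hwb, hwd⟩ := hb
    have hact : ActsOn (Finset.univ.filter fun i => w i ≠ 0) (shiftError w) :=
      actsOn_shiftError fun i hi => by simpa using hi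
    have h := hd' _ (lt_of_le_of_lt hwb (not_le.1 hlt)) _ hact
    by_cases hwD : w ∈ dualCode A
    · refine not_isPureFor_shiftError hw0 hwD (h.2 ?_)
      rw [finrank_cssCode hA, ← hwd hwD, Nat.sub_self, pow_zero]
    · exact not_detects_shiftError hw hwD h.1
  have hne : {d' | DetectsBelow (cssCode A A) d'}.Nonempty := ⟨d, hmem⟩
  have hbdd : BddAbove {d' | DetectsBelow (cssCode A A) d'} := ⟨b, fun d' h => hbound d' h⟩
  exact ⟨_, ⟨finrank_cssCode hA, Nat.sSup_mem hne hbdd, fun _ h => le_csSup hbdd h⟩,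
    le_csSup hbdd hmem, hbound _ (Nat.sSup_mem hne hbdd)⟩

end Quantum

/-! ### Affine functions and the dual parity code. -/

section ParityCode

variable (K : Type*) {ι V : Type*} [Field K] [AddCommGroup V] [Module K V]

/-- Evaluation of an affine function on `V` at all labels. -/
def affineEval (e : ι ≃ V) : K × Module.Dual K V →ₗ[K] (ι → K) where
  toFun a i := a.1 + a.2 (e i)
  map_add' a b := by
    funext i
    simp only [Prod.fst_add, Prod.snd_add, LinearMap.add_apply, Pi.add_apply]
    ring
  map_smul' c a := by
    funext i
    simp [mul_add]

theorem affineEval_injective (e : ι ≃ V) : Function.Injective (affineEval K e) := by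
  refine (injective_iff_map_eq_zero _).2 fun a ha => ?_
  have h : ∀ v, a.1 + a.2 v = 0 := fun v => by
    simpa [affineEval] using congrFun ha (e.symm v)
  have h0 : a.1 = 0 := by simpa using h 0
  refine Prod.ext h0 (LinearMap.ext fun v => ?_)
  simpa [h0] using h v

/-- The words of the values of affine functions on `V`. -/
def affineWords (e : ι ≃ V) : Submodule K (ι → K) := LinearMap.range (affineEval K e)

theorem finrank_affineWords [FiniteDimensional K V] (e : ι ≃ V) :
    Module.finrank K (affineWords K e) = 1 + Module.finrank K V := by
  rw [affineWords, LinearMap.finrank_range_of_inj (affineEval_injective K e),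
    Module.finrank_prod, Module.finrank_self, Subspace.dual_finrank_eq]

variable [Fintype ι]

/-- The words over `K`, with coordinates labelled by the vectors of `V`, whose entries and whose
labels weighted by the entries both sum to zero. -/
def parityCode (e : ι ≃ V) : Submodule K (ι → K) where
  carrier := {x | ∑ i, x i = 0 ∧ ∑ i, x i • e i = 0}
  zero_mem' := by simp
  add_mem' := by
    rintro a b ⟨h1, h2⟩ ⟨h3, h4⟩
    simp [Finset.sum_add_distrib, add_smul, h1, h2, h3, h4]
  smul_mem' := by
    rintro c a ⟨h1, h2⟩
    simp [mul_smul, ← Finset.mul_sum, ← Finset.smul_sum, h1, h2]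

/-- Pairing the function c + l with x gives c ∑ x_i + l(∑ x_i e_i), and linear functionals separate
the vectors of V. -/
theorem dualCode_affineWords (e : ι ≃ V) : dualCode (affineWords K e) = parityCode K e := by
  have key : ∀ (c : K) (l : Module.Dual K V) (x : ι → K),
      affineEval K e (c, l) ⬝ᵥ x = c * ∑ i, x i + l (∑ i, x i • e i) := by
    intro c l x
    simp only [dotProduct, affineEval, LinearMap.coe_mk, AddHom.coe_mk, map_sum, map_smul,
      smul_eq_mul, Finset.mul_sum, ← Finset.sum_add_distrib]
    exact Finset.sum_congr rfl fun i _ => by ring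
  ext x
  constructor
  · intro hx
    have h1 := fun c l => (key c l x).symm.trans (hx _ ⟨(c, l), rfl⟩)
    refine ⟨by simpa using h1 1 0, (Module.forall_dual_apply_eq_zero_iff K _).1 fun l => ?_⟩
    simpa using h1 0 l
  · rintro ⟨h1, h2⟩ _ ⟨⟨c, l⟩, rfl⟩
    rw [key, h1, h2]
    simp

theorem dualCode_parityCode (e : ι ≃ V) : dualCode (parityCode K e) = affineWords K e := by
  rw [← dualCode_affineWords, dualCode_dualCode]

variable [FiniteDimensional K V]

theorem finrank_parityCode (e : ι ≃ V) :
    1 + Module.finrank K V + Module.finrank K (parityCode K e) = Fintype.card ι := by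
  rw [← finrank_affineWords K e, ← dualCode_affineWords, finrank_add_finrank_dualCode]

/-- In coordinates, the inner product of two affine words is the sum over K^M of a polynomial of
degree at most 2, and such sums vanish when the degree is below (q - 1)M. -/
theorem affineWords_le_parityCode [Fintype K] (e : ι ≃ V)
    (h : 2 < (Fintype.card K - 1) * Module.finrank K V) :
    affineWords K e ≤ parityCode K e := by
  classical
  rw [← dualCode_affineWords]
  rintro _ ⟨⟨c, l⟩, rfl⟩ _ ⟨⟨c', l'⟩, rfl⟩
  let b := Module.finBasis K V
  let f : K → Module.Dual K V → MvPolynomial (Fin (Module.finrank K V)) K := fun c l =>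
    MvPolynomial.C c + ∑ i, MvPolynomial.C (l (b i)) * MvPolynomial.X i
  have hf : ∀ c l, (f c l).totalDegree ≤ 1 := by
    intro c l
    refine (MvPolynomial.totalDegree_add _ _).trans (max_le (by simp) ?_)
    refine MvPolynomial.totalDegree_finsetSum_le fun i _ => ?_
    refine (MvPolynomial.totalDegree_mul _ _).trans ?_
    simp
  have hev : ∀ c l y, MvPolynomial.eval y (f c l) = c + l (b.equivFun.symm y) := by
    intro c l y
    simp [f, Module.Basis.equivFun_symm_apply, mul_comm]
  have hs := MvPolynomial.sum_eval_eq_zero (f c' l' * f c l) (by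
    refine lt_of_le_of_lt (MvPolynomial.totalDegree_mul _ _) ?_
    rw [Fintype.card_fin]
    have := hf c l
    have := hf c' l'
    omega)
  rw [← hs, dotProduct, ← Equiv.sum_comp (b.equivFun.symm.toEquiv.trans e.symm)]
  refine Finset.sum_congr rfl fun y _ => ?_
  rw [map_mul, hev, hev]
  simp [affineEval]

/-- A word of the parity code is a linear relation among the vectors (1, e i) of K × V. -/
theorem exists_mem_parityCode_support_subset [DecidableEq ι] (e : ι ≃ V) {S : Finset ι}
    (hS : 1 + Module.finrank K V < S.card) :
    ∃ w ∈ parityCode K e, w ≠ 0 ∧ ∀ i ∉ S, w i = 0 := by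
  let f : (S → K) →ₗ[K] K × V := Fintype.linearCombination K fun i : S => ((1 : K), e i)
  have hf : LinearMap.ker f ≠ ⊥ := by
    refine LinearMap.ker_ne_bot_of_finrank_lt ?_
    rw [Module.finrank_prod, Module.finrank_self, Module.finrank_fintype_fun_eq_card,
      Fintype.card_coe]
    exact hS
  obtain ⟨u, hu, hu0⟩ := Submodule.exists_mem_ne_zero_of_ne_bot hf
  rw [LinearMap.mem_ker, Fintype.linearCombination_apply, Prod.ext_iff, Prod.fst_sum,
    Prod.snd_sum] at hu
  let w : ι → K := fun i => if h : i ∈ S then u ⟨i, h⟩ else 0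
  have hwS : ∀ i ∉ S, w i = 0 := fun i hi => dif_neg hi
  have hwu : ∀ i : S, w i = u i := fun i => dif_pos i.2
  refine ⟨w, ⟨?_, ?_⟩, ?_, hwS⟩
  · rw [← Finset.sum_subset S.subset_univ fun i _ hi => hwS i hi, ← Finset.sum_coe_sort]
    simpa [hwu] using hu.1
  · rw [← Finset.sum_subset S.subset_univ fun i _ hi => by rw [hwS i hi, zero_smul],
      ← Finset.sum_coe_sort]
    simpa [hwu] using hu.2
  · intro h0
    refine hu0 (funext fun i => ?_)
    rw [← hwu, h0]
    rfl

theorem exists_mem_parityCode_hammingNorm_le [DecidableEq K] (e : ι ≃ V)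
    (h : affineWords K e ≤ parityCode K e) :
    ∃ w ∈ parityCode K e, w ≠ 0 ∧ hammingNorm w ≤ Module.finrank K V + 2 ∧
      (w ∈ affineWords K e → parityCode K e = affineWords K e) := by
  classical
  set M := Module.finrank K V
  have hrank := finrank_parityCode K e
  have hle := Submodule.finrank_mono h
  rw [finrank_affineWords] at hle
  have hnorm : ∀ (S : Finset ι) (w : ι → K), S.card = M + 2 → (∀ i ∉ S, w i = 0) →
      hammingNorm w ≤ M + 2 := by
    intro S w hS hw
    rw [← hS]
    refine Finset.card_le_card fun i hi => ?_
    by_contra hiS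
    simp [hw i hiS] at hi
  -- Here both codes have dimension M + 1, so they coincide and any word serves.
  by_cases hN : Fintype.card ι = 2 * M + 2
  · obtain ⟨S, -, hS⟩ := Finset.exists_subset_card_eq (s := (Finset.univ : Finset ι))
      (n := M + 2) (by rw [Finset.card_univ]; omega)
    obtain ⟨w, hw, hw0, hwS⟩ := exists_mem_parityCode_support_subset K e (S := S) (by omega)
    refine ⟨w, hw, hw0, hnorm S w hS hwS, fun _ => ?_⟩
    refine (Submodule.eq_of_le_of_finrank_eq h ?_).symm
    rw [finrank_affineWords]
    omega
  -- Now there are at least 2M + 3 labels, leaving M + 2 outside the affine frame formed by 0 and a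
  -- basis. An affine function vanishing on that frame is zero, so the word found is not affine.
  · let b := Module.finBasis K V
    let I : Finset ι := insert (e.symm 0) (Finset.univ.image fun i => e.symm (b i))
    have hI : I.card ≤ M + 1 := by
      refine (Finset.card_insert_le _ _).trans (Nat.succ_le_succ ?_)
      refine Finset.card_image_le.trans ?_
      simp [M]
    obtain ⟨S, hSI, hS⟩ := Finset.exists_subset_card_eq (s := Iᶜ) (n := M + 2)
      (by rw [Finset.card_compl]; omega)
    obtain ⟨w, hw, hw0, hwS⟩ := exists_mem_parityCode_support_subset K e (S := S) (by omega)
    refine ⟨w, hw, hw0, hnorm S w hS hwS, ?_⟩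
    rintro ⟨⟨c, l⟩, rfl⟩
    have hz : ∀ v, e.symm v ∈ I → c + l v = 0 := by
      intro v hv
      have := hwS (e.symm v) fun hvS => Finset.mem_compl.1 (hSI hvS) hv
      simpa [affineEval] using this
    have hc : c = 0 := by simpa using hz 0 (Finset.mem_insert_self _ _)
    have hl : l = 0 := b.ext fun i => by
      simpa [hc] using hz (b i)
        (Finset.mem_insert_of_mem (Finset.mem_image_of_mem _ (Finset.mem_univ i)))
    exact absurd (by rw [hc, hl]; exact map_zero _) hw0

end ParityCode

/-! ### Cyclic and extended codes described by power sums. -/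

section Cyclic

variable {K G : Type*} [Field K] [Field G] [Algebra K G] {n : ℕ} {β : G} {g : K[X]}

theorem mem_cyclicCode_iff_dvd (hg : g ∣ X ^ n - 1) {c : Fin n → K} :
    c ∈ cyclicCode n g ↔ g ∣ ∑ i : Fin n, C (c i) * X ^ (i : ℕ) := by
  change wordClass c ∈ Ideal.span {(Ideal.Quotient.mk _ g : CyclicAlgebra K n)} ↔ _
  rw [Ideal.mem_span_singleton, wordClass]
  constructor
  · rintro ⟨a, ha⟩
    obtain ⟨a, rfl⟩ := Ideal.Quotient.mk_surjective a
    rw [← map_mul, Ideal.Quotient.eq, Ideal.mem_span_singleton] at ha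
    exact (dvd_sub_left (dvd_mul_right g a)).1 (hg.trans ha)
  · exact map_dvd _

/-- Over G, X^n - 1 is a product of distinct linear factors X - β^i, so g splits with simple roots.
-/
theorem dvd_iff_forall_mem_definingSet (hn : 0 < n) (hβ : IsPrimitiveRoot β n)
    (hg : g ∣ X ^ n - 1) {P : K[X]} :
    g ∣ P ↔ ∀ i ∈ definingSet n β g, aeval (β ^ i) P = 0 := by
  constructor
  · intro h i hi
    exact aeval_eq_zero_of_dvd_aeval_eq_zero h hi.2
  · intro h
    by_cases hP : P = 0
    · rw [hP]
      exact dvd_zero g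
    have : NeZero n := ⟨hn.ne'⟩
    have h0 : (X ^ n - 1 : G[X]) ≠ 0 := X_pow_sub_C_ne_zero hn 1
    have hgG : g.map (algebraMap K G) ∣ X ^ n - 1 := by
      simpa using Polynomial.map_dvd (algebraMap K G) hg
    have hnodup : (g.map (algebraMap K G)).roots.Nodup := by
      refine Multiset.nodup_of_le (roots.le_of_dvd h0 hgG) ?_
      simpa [nthRoots] using hβ.nthRoots_one_nodup
    have hsplit : (g.map (algebraMap K G)).Splits := by
      refine Splits.of_dvd ?_ h0 hgG
      rw [X_pow_sub_one_eq_prod hn hβ]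
      exact Splits.prod fun ζ _ => Splits.X_sub_C ζ
    rw [← Polynomial.map_dvd_map' (algebraMap K G)]
    refine hsplit.dvd_of_roots_le_roots (ne_zero_of_dvd_ne_zero h0 hgG) ?_
    rw [Multiset.le_iff_subset hnodup]
    intro ζ hζ
    have hζ1 : ζ ^ n = 1 := by
      have := (isRoot_of_mem_roots hζ).dvd hgG
      simpa [sub_eq_zero] using this
    obtain ⟨i, hi, rfl⟩ := hβ.eq_pow_of_pow_eq_one hζ1
    rw [mem_roots (Polynomial.map_ne_zero hP), IsRoot, eval_map_algebraMap]
    refine h i ⟨hi, ?_⟩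
    rw [← eval_map_algebraMap]
    exact isRoot_of_mem_roots hζ

variable [Fintype G]

theorem sum_univ_eq_add_sum_pow (hn : n + 1 = Fintype.card G) (hβ : IsPrimitiveRoot β n)
    {M : Type*} [AddCommMonoid M] (f : G → M) : ∑ u, f u = f 0 + ∑ i : Fin n, f (β ^ (i : ℕ)) := by
  classical
  have hinj : Function.Injective fun i : Fin n => β ^ (i : ℕ) := fun i j h =>
    Fin.ext (hβ.pow_inj i.2 j.2 h)
  have h0 : (0 : G) ∉ Finset.univ.image fun i : Fin n => β ^ (i : ℕ) := by
    simp only [Finset.mem_image, Finset.mem_univ, true_and, not_exists]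
    intro i
    exact pow_ne_zero _ (hβ.ne_zero (Nat.ne_zero_of_lt i.2))
  have hu : insert (0 : G) (Finset.univ.image fun i : Fin n => β ^ (i : ℕ)) = Finset.univ := by
    refine Finset.eq_univ_of_card _ ?_
    rw [Finset.card_insert_of_notMem h0, Finset.card_image_of_injective _ hinj, Finset.card_fin, hn]
  rw [← hu, Finset.sum_insert h0, Finset.sum_image fun i _ j _ h => hinj h]

theorem sum_pow_eq_ite (hn : n + 1 = Fintype.card G) (hβ : IsPrimitiveRoot β n) {k : ℕ}
    (hk : k ≠ 0) : ∑ u : G, u ^ k = if n ∣ k then -1 else 0 := by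
  rw [sum_univ_eq_add_sum_pow hn hβ, zero_pow hk, zero_add]
  split_ifs with h
  · have h1 : ∀ i : Fin n, (β ^ (i : ℕ)) ^ k = 1 := fun i => by
      rw [pow_right_comm, (hβ.pow_eq_one_iff_dvd k).2 h, one_pow]
    have h2 : (n : G) + 1 = 0 := by
      rw [← Nat.cast_one, ← Nat.cast_add, hn, FiniteField.cast_card_eq_zero]
    simp only [h1, Finset.sum_const, Finset.card_univ, Fintype.card_fin, nsmul_one]
    exact eq_neg_of_add_eq_zero_left h2
  · have h1 : β ^ k ≠ 1 := fun h1 => h ((hβ.pow_eq_one_iff_dvd k).1 h1)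
    have h2 := mul_geom_sum (β ^ k) n
    rw [pow_right_comm, hβ.pow_eq_one, one_pow, sub_self, ← Fin.sum_univ_eq_sum_range] at h2
    simp only [pow_right_comm β _ k]
    exact (mul_eq_zero.1 h2).resolve_left (sub_ne_zero.2 h1)

theorem mem_extendedCode_iff (hn : n + 1 = Fintype.card G) (hβ : IsPrimitiveRoot β n)
    (hn0 : 0 < n) (hg : g ∣ X ^ n - 1) {x : G → K} :
    x ∈ extendedCode n β g ↔ ∑ u, x u = 0 ∧
      ∀ i ∈ definingSet n β g, ∑ k : Fin n, x (β ^ (k : ℕ)) • (β ^ (k : ℕ)) ^ i = 0 := by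
  change _ ∈ cyclicCode n g ∧ _ ↔ _
  rw [mem_cyclicCode_iff_dvd hg, dvd_iff_forall_mem_definingSet hn0 hβ hg, and_comm,
    sum_univ_eq_add_sum_pow hn hβ, eq_neg_iff_add_eq_zero]
  refine and_congr_right fun _ => forall₂_congr fun i _ => ?_
  simp [Algebra.smul_def, pow_right_comm β]

/-- For positive exponents the label 0 contributes nothing, so the sums may run over all of G. -/
theorem mem_extendedCode_iff_of_zero_notMem (hn : n + 1 = Fintype.card G)
    (hβ : IsPrimitiveRoot β n) (hn0 : 0 < n) (hg : g ∣ X ^ n - 1) (h0 : 0 ∉ definingSet n β g)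
    {x : G → K} : x ∈ extendedCode n β g ↔ ∑ u, x u = 0 ∧
      ∀ i ∈ definingSet n β g, ∑ u, x u • u ^ i = 0 := by
  rw [mem_extendedCode_iff hn hβ hn0 hg]
  refine and_congr_right fun _ => forall₂_congr fun i hi => ?_
  rw [sum_univ_eq_add_sum_pow hn hβ]
  rw [zero_pow, smul_zero, zero_add]
  rintro rfl
  exact h0 hi

end Cyclic

/-! ### Arithmetic of cyclotomic classes and binomial coefficients. -/

theorem exists_modEq_mul_pow {n q M a b l : ℕ} (hq : q ^ M ≡ 1 [MOD n]) (hM : M ≠ 0)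
    (h : a ≡ b * q ^ l [MOD n]) : ∃ l', b ≡ a * q ^ l' [MOD n] := by
  refine ⟨M * l - l, ?_⟩
  have h1 : l + (M * l - l) = M * l :=
    Nat.add_sub_of_le (Nat.le_mul_of_pos_left l (Nat.pos_of_ne_zero hM))
  have h2 := h.mul_right (q ^ (M * l - l))
  rw [mul_assoc, ← pow_add, h1, pow_mul] at h2
  have h3 := (hq.pow l).mul_left b
  rw [one_pow, mul_one] at h3
  exact (h2.trans h3).symm

theorem zero_notMem_cyclotomicClass {q n j : ℕ} (hcop : Nat.Coprime n q) (hjn : j < n)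
    (hj0 : j ≠ 0) : 0 ∉ cyclotomicClass q n j := by
  rintro ⟨-, l, hl⟩
  have h1 : n ∣ j * q ^ l := (Nat.modEq_zero_iff_dvd).1 hl.symm
  exact Nat.not_dvd_of_pos_of_lt (Nat.pos_of_ne_zero hj0) hjn
    ((hcop.pow_right l).dvd_of_dvd_mul_right h1)

/-- Lucas' congruence strips one factor p from both entries at a time, down to (u choose 1) = u. -/
theorem not_dvd_choose_prime_pow_mul {p u : ℕ} (hp : p.Prime) (hu : ¬ p ∣ u) (s : ℕ) :
    ¬ p ∣ (p ^ s * u).choose (p ^ s) := by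
  have : Fact p.Prime := ⟨hp⟩
  induction s with
  | zero => simpa using hu
  | succ s ih =>
    have h := Choose.choose_modEq_choose_mod_mul_choose_div_nat (p := p) (n := p ^ (s + 1) * u)
      (k := p ^ (s + 1))
    rw [pow_succ', mul_assoc, Nat.mul_mod_right, Nat.mul_mod_right,
      Nat.mul_div_cancel_left _ hp.pos, Nat.mul_div_cancel_left _ hp.pos, Nat.choose_self,
      one_mul] at h
    rwa [pow_succ', mul_assoc, h.dvd_iff dvd_rfl]

/-! ### Which extended cyclic codes are affine-invariant. -/

section AffineInvariance

variable {K G : Type*} [Field K] [Field G] [Fintype G] [Algebra K G]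

/-- By nondegeneracy of the trace form, the coordinates of y(u) in a K-basis of G are traces Tr(c_i
y(u)). This passes from K-valued codewords to G-valued functions. -/
theorem sum_mul_eq_zero_of_forall_trace {y f : G → G}
    (h : ∀ c, ∑ u, Algebra.trace K G (c * y u) • f u = 0) : ∑ u, y u * f u = 0 := by
  have : Algebra.IsSeparable K G := inferInstance
  let b := Module.finBasis K G
  have hnd := traceForm_nondegenerate K G
  let c := fun i => ((Algebra.traceForm K G).toDual hnd).symm (b.coord i)
  have hc : ∀ i v, Algebra.trace K G (c i * v) = b.repr v i := fun i v =>
    LinearMap.BilinForm.apply_toDual_symm_apply (hB := hnd) (b.coord i) v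
  calc ∑ u, y u * f u = ∑ u, ∑ i, (b.repr (y u) i • b i) * f u := by
        refine Finset.sum_congr rfl fun u _ => ?_
        rw [← Finset.sum_mul, b.sum_repr]
    _ = ∑ i, b i * ∑ u, Algebra.trace K G (c i * y u) • f u := by
        rw [Finset.sum_comm]
        refine Finset.sum_congr rfl fun i _ => ?_
        rw [Finset.mul_sum]
        refine Finset.sum_congr rfl fun u _ => ?_
        rw [hc, smul_mul_assoc, mul_smul_comm]
    _ = 0 := by simp [h]

theorem IsAffineInvariant.sum_smul_add_one_pow {A : Submodule K (G → K)} (hA : IsAffineInvariant A)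
    {j : ℕ} (hj : ∀ x ∈ A, ∑ u, x u • u ^ j = 0) {x : G → K} (hx : x ∈ A) :
    ∑ u, x u • (u + 1) ^ j = 0 := by
  have hσ : Equiv.addRight (-1 : G) ∈ permGroup A :=
    hA ⟨1, -1, one_ne_zero, fun u => by simp⟩
  have h := hj _ ((hσ x).2 hx)
  rw [← Equiv.sum_comp (Equiv.addRight (1 : G))] at h
  simpa using h

theorem isAffineInvariant_parityCode (e : G ≃+* G) :
    IsAffineInvariant (parityCode K e.toEquiv) := by
  rintro σ ⟨a, b, ha, hσ⟩ x
  have h1 : ∑ u, (x ∘ σ) u = ∑ u, x u := Equiv.sum_comp σ x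
  have h2 : ∑ u, x u • e u = e a * ∑ u, (x ∘ σ) u • e u + (∑ u, x u) • e b := by
    rw [← Equiv.sum_comp σ, ← h1, Finset.mul_sum, Finset.sum_smul, ← Finset.sum_add_distrib]
    refine Finset.sum_congr rfl fun u _ => ?_
    rw [hσ, map_add, map_mul, smul_add, mul_smul_comm, Function.comp_apply, hσ]
  change (∑ u, (x ∘ σ) u = 0 ∧ ∑ u, (x ∘ σ) u • e u = 0) ↔
    (∑ u, x u = 0 ∧ ∑ u, x u • e u = 0)
  rw [h1]
  refine and_congr_right fun h => ?_
  rw [h2, h, zero_smul, add_zero, mul_eq_zero, or_iff_right]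
  simpa using ha

variable [Fintype K] {n : ℕ} {β : G} {g : K[X]}

theorem card_pow_finrank_modEq_one (hn : n + 1 = Fintype.card G) :
    Fintype.card K ^ Module.finrank K G ≡ 1 [MOD n] := by
  rw [← Module.card_eq_pow_finrank (K := K) (V := G), ← hn]
  simp [Nat.ModEq]

theorem coprime_card_of_add_one_eq_card (hn : n + 1 = Fintype.card G) :
    Nat.Coprime n (Fintype.card K) := by
  have h : Nat.Coprime n (Fintype.card K ^ Module.finrank K G) := by
    rw [← Module.card_eq_pow_finrank, ← hn]
    simp
  exact (Nat.coprime_pow_right_iff Module.finrank_pos _ _).1 h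

theorem trace_mul_sum_eq_zero {y f : G → G}
    (h : ∀ l, ∑ u, y u ^ Fintype.card K ^ l * f u = 0) (c : G) :
    ∑ u, Algebra.trace K G (c * y u) • f u = 0 := by
  simp only [Algebra.smul_def, FiniteField.algebraMap_trace_eq_sum_pow, Finset.sum_mul, mul_pow]
  rw [Finset.sum_comm]
  refine Finset.sum_eq_zero fun l _ => ?_
  rw [Nat.card_eq_fintype_card]
  simp only [mul_assoc]
  rw [← Finset.mul_sum, h, mul_zero]

/-- The defining set of a cyclic code whose extended code is affine-invariant is closed under
passing to the lowest power of `p` in an exponent. -/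
theorem exists_prime_pow_mem_cyclotomicClass {p : ℕ} (hp : p.Prime) [CharP G p]
    (hn : n + 1 = Fintype.card G) (hβ : IsPrimitiveRoot β n) (hg : g ∣ X ^ n - 1)
    {j : ℕ} (hjn : j < n) (hj0 : j ≠ 0)
    (hT : definingSet n β g = cyclotomicClass (Fintype.card K) n j)
    (hA : IsAffineInvariant (extendedCode n β g)) :
    ∃ s, p ^ s ∈ definingSet n β g := by
  classical
  set q := Fintype.card K
  have hn0 : 0 < n := by omega
  have hcop : Nat.Coprime n q := coprime_card_of_add_one_eq_card hn
  have hqM : q ^ Module.finrank K G ≡ 1 [MOD n] := card_pow_finrank_modEq_one hn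
  have hT0 : 0 ∉ definingSet n β g := by
    rw [hT]
    exact zero_notMem_cyclotomicClass hcop hjn hj0
  have hmem := fun x => mem_extendedCode_iff_of_zero_notMem (x := x) hn hβ hn0 hg hT0
  have hjT : j ∈ definingSet n β g := by
    rw [hT]
    exact ⟨hjn, 0, by simp [Nat.ModEq]⟩
  obtain ⟨s, u, hu, hju⟩ := Nat.exists_eq_pow_mul_and_not_dvd hj0 p hp.ne_one
  refine ⟨s, ?_⟩
  by_contra hs
  have hPpos : 0 < p ^ s := pow_pos hp.pos s
  have hPj : p ^ s ≤ j := Nat.le_of_dvd (Nat.pos_of_ne_zero hj0) ⟨u, hju⟩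
  have hclass : ∀ i l, i ≡ p ^ s * q ^ l [MOD n] → i ∉ definingSet n β g := by
    intro i l hil hi
    rw [hT] at hi hs
    obtain ⟨-, a, ha⟩ := hi
    obtain ⟨l', hl'⟩ := exists_modEq_mul_pow hqM Module.finrank_pos.ne' hil
    refine hs ⟨by omega, a + l', hl'.trans ?_⟩
    rw [pow_add, ← mul_assoc]
    exact ha.mul_right _
  -- With this exponent, u^e pairs nontrivially with u^(p^s), since ∑ u^n = -1, while the conjugates
  -- of u^e pair to zero with every power outside the class of p^s.
  set e := n - p ^ s with he
  have hdvd : ∀ i l, n ∣ e * q ^ l + i → i ≡ p ^ s * q ^ l [MOD n] := by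
    intro i l h
    have h1 : e * q ^ l + i + p ^ s * q ^ l = n * q ^ l + i := by
      rw [add_right_comm, ← add_mul, he, Nat.sub_add_cancel (by omega)]
    have h2 : n * q ^ l + i ≡ 0 + p ^ s * q ^ l [MOD n] := by
      rw [← h1]
      exact Nat.ModEq.add_right _ ((Nat.modEq_zero_iff_dvd).2 h)
    rw [zero_add] at h2
    refine Nat.ModEq.trans ?_ h2
    simp [Nat.ModEq]
  have hvan : ∀ i, (∀ l, ¬ i ≡ p ^ s * q ^ l [MOD n]) → ∀ c : G,
      ∑ u : G, Algebra.trace K G (c * u ^ e) • u ^ i = 0 := by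
    intro i hi c
    refine trace_mul_sum_eq_zero (fun l => ?_) c
    have h1 : e * q ^ l + i ≠ 0 := by
      have := Nat.mul_pos (show 0 < e by omega) (pow_pos (Fintype.card_pos (α := K)) l)
      exact (Nat.add_pos_left this i).ne'
    have h2 := sum_pow_eq_ite hn hβ h1
    rw [if_neg fun h => hi l (hdvd i l h)] at h2
    simpa only [← pow_mul, ← pow_add] using h2
  have hword : ∀ c : G, (fun u => Algebra.trace K G (c * u ^ e)) ∈ extendedCode n β g := by
    intro c
    refine (hmem _).2 ⟨?_, fun i hi => hvan i (fun l hl => hclass i l hl hi) c⟩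
    have := hvan 0 (fun l hl => ?_) c
    · apply (algebraMap K G).injective
      rw [map_zero, ← this, map_sum]
      simp [Algebra.smul_def]
    · have h1 : n ∣ p ^ s * q ^ l := (Nat.modEq_zero_iff_dvd).1 hl.symm
      exact Nat.not_dvd_of_pos_of_lt hPpos (by omega)
        ((hcop.pow_right l).dvd_of_dvd_mul_right h1)
  have hsum := sum_mul_eq_zero_of_forall_trace fun c =>
    hA.sum_smul_add_one_pow (fun x hx => ((hmem x).1 hx).2 j hjT) (hword c)
  have hexp : ∑ u : G, u ^ e * (u + 1) ^ j = -(j.choose (p ^ s) : G) := by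
    calc ∑ u : G, u ^ e * (u + 1) ^ j
        = ∑ t ∈ Finset.range (j + 1), (∑ u : G, u ^ (e + t)) * (j.choose t : G) := by
          simp only [add_pow, Finset.mul_sum, Finset.sum_mul, one_pow, mul_one]
          rw [Finset.sum_comm]
          simp only [pow_add, mul_assoc]
      _ = (∑ u : G, u ^ (e + p ^ s)) * (j.choose (p ^ s) : G) := by
          -- Since 0 < e + t < 2n, the power sum survives only for e + t = n, that is t = p^s.
          refine Finset.sum_eq_single_of_mem _ (Finset.mem_range.2 (by omega)) fun t ht hne => ?_
          rw [sum_pow_eq_ite hn hβ (by omega), if_neg, zero_mul]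
          rintro ⟨k, hk⟩
          rw [Finset.mem_range] at ht
          have hk2 : k < 2 := by
            by_contra hk2
            have := Nat.mul_le_mul_left n (not_lt.1 hk2)
            omega
          interval_cases k <;> omega
      _ = _ := by
          rw [sum_pow_eq_ite hn hβ (by omega), if_pos, neg_one_mul]
          rw [he, Nat.sub_add_cancel (by omega)]
  rw [hsum, eq_comm, neg_eq_zero, CharP.cast_eq_zero_iff G p, hju] at hexp
  exact not_dvd_choose_prime_pow_mul hp hu s hexp

/-- This code is cut out by ∑ x_u = 0 and x_0 = 0, and a translation can move a nonzero entry to the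
label 0. -/
theorem not_isAffineInvariant_of_zero (hn : n + 1 = Fintype.card G) (hβ : IsPrimitiveRoot β n)
    (hn1 : 1 < n) (hg : g ∣ X ^ n - 1)
    (hT : definingSet n β g = cyclotomicClass (Fintype.card K) n 0) :
    ¬ IsAffineInvariant (extendedCode n β g) := by
  classical
  intro hA
  have hT' : definingSet n β g = {0} := by
    rw [hT]
    ext i
    constructor
    · rintro ⟨hi, l, hl⟩
      rw [zero_mul] at hl
      exact Nat.ModEq.eq_of_lt_of_lt hl hi (by omega)
    · rintro rfl
      exact ⟨by omega, 0, by simp [Nat.ModEq]⟩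
  have hmem : ∀ x : G → K, x ∈ extendedCode n β g ↔ ∑ u, x u = 0 ∧ x 0 = 0 := by
    intro x
    rw [mem_extendedCode_iff hn hβ (by omega) hg, hT']
    refine and_congr_right fun h => ?_
    rw [sum_univ_eq_add_sum_pow hn hβ] at h
    have h1 : ∑ k : Fin n, x (β ^ (k : ℕ)) • (β ^ (k : ℕ)) ^ 0 =
        algebraMap K G (∑ k : Fin n, x (β ^ (k : ℕ))) := by
      simp [Algebra.smul_def]
    simp only [Set.mem_singleton_iff, forall_eq, h1, map_eq_zero]
    constructor
    · intro h2
      rwa [h2, add_zero] at h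
    · intro h2
      rwa [h2, zero_add] at h
  have hβ1 : β ≠ 1 := hβ.ne_one hn1
  have hβ0 : β ≠ 0 := hβ.ne_zero (by omega)
  have hx : (Pi.single 1 1 - Pi.single β 1 : G → K) ∈ extendedCode n β g := by
    rw [hmem]
    simp [Finset.sum_sub_distrib, hβ0.symm]
  have hσ : Equiv.addRight (1 : G) ∈ permGroup (extendedCode n β g) :=
    hA ⟨1, 1, one_ne_zero, fun u => by simp⟩
  have h := ((hmem _).1 ((hσ _).2 hx)).2
  simp [hβ1.symm] at h

/-- The q^l-power map is K-linear, so it carries the condition for p^s to the one for p^s q^l. -/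
theorem extendedCode_eq_parityCode {p : ℕ} (hp : p.Prime) [CharP G p] [ExpChar G p]
    [PerfectRing G p]
    (hn : n + 1 = Fintype.card G) (hβ : IsPrimitiveRoot β n) (hn0 : 0 < n) (hg : g ∣ X ^ n - 1)
    (h0 : 0 ∉ definingSet n β g) {s : ℕ} (hs : p ^ s ∈ definingSet n β g)
    (hT : ∀ i ∈ definingSet n β g, ∃ l, i ≡ p ^ s * Fintype.card K ^ l [MOD n]) :
    extendedCode n β g = parityCode K (iterateFrobeniusEquiv G p s).toEquiv := by
  ext x
  rw [mem_extendedCode_iff_of_zero_notMem hn hβ hn0 hg h0]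
  refine and_congr_right fun _ => ?_
  constructor
  · exact fun h => h _ hs
  · intro h i hi
    obtain ⟨l, hl⟩ := hT i hi
    have hi0 : i ≠ 0 := by
      rintro rfl
      exact h0 hi
    have hpow : ∀ u : G, u ^ i = (u ^ p ^ s) ^ Fintype.card K ^ l := by
      intro u
      rw [← pow_mul]
      by_cases hu : u = 0
      · rw [hu, zero_pow hi0, zero_pow]
        exact (Nat.mul_pos (pow_pos hp.pos s) (pow_pos Fintype.card_pos l)).ne'
      · have hu1 : u ^ n = 1 := by
          have := FiniteField.pow_card_sub_one_eq_one u hu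
          rwa [← hn, Nat.add_sub_cancel] at this
        exact pow_eq_pow_of_modEq hl hu1
    have hφ := congrArg (FiniteField.frobeniusAlgHom K G ^ l) h
    rw [map_zero, map_sum] at hφ
    rw [← hφ]
    refine Finset.sum_congr rfl fun u _ => ?_
    rw [map_smul, hpow]
    congr 1
    rw [AlgHom.coe_pow, FiniteField.coe_frobeniusAlgHom, pow_iterate]
    rfl

/-- The conjugates of β over K are its images under powers of the q-Frobenius, which exhaust the
Galois group. -/
theorem definingSet_minpoly (hβ : IsPrimitiveRoot β n) :
    definingSet n β (minpoly K β) = cyclotomicClass (Fintype.card K) n 1 := by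
  ext i
  refine and_congr_right fun hi => ?_
  have hpow : ∀ l, (FiniteField.frobeniusAlgEquivOfAlgebraic K G ^ l) β =
      β ^ Fintype.card K ^ l := by
    intro l
    rw [AlgEquiv.coe_pow, FiniteField.coe_frobeniusAlgEquivOfAlgebraic, pow_iterate]
  have hmod : ∀ l, i ≡ 1 * Fintype.card K ^ l [MOD n] ↔ β ^ i = β ^ Fintype.card K ^ l := by
    intro l
    rw [one_mul]
    have hu := hβ.isUnit (Nat.ne_zero_of_lt hi)
    have ho : n = orderOf hu.unit := by rw [hβ.eq_orderOf, ← orderOf_units, hu.unit_spec]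
    rw [ho, ← pow_eq_pow_iff_modEq, Units.ext_iff]
    simp
  simp only [hmod]
  rw [← isConjRoot_iff_aeval_eq_zero (Algebra.IsIntegral.isIntegral β), isConjRoot_def,
    eq_comm, ← isConjRoot_def, isConjRoot_iff_exists_algEquiv]
  constructor
  · rintro ⟨σ, hσ⟩
    obtain ⟨l, hl⟩ := (FiniteField.bijective_frobeniusAlgEquivOfAlgebraic_pow K G).2 σ
    refine ⟨l, ?_⟩
    rw [← hσ, ← hl]
    exact hpow l
  · rintro ⟨l, hl⟩
    exact ⟨FiniteField.frobeniusAlgEquivOfAlgebraic K G ^ l, by rw [hpow, hl]⟩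

end AffineInvariance

/-! ### Existence and classification of the codes. -/

section Main

variable {K G : Type*} [Field K] [Fintype K] [Field G] [Fintype G] [Algebra K G] {n p : ℕ} {β : G}

theorem exists_isExtendedMaximalAffineInvariant (hp : p.Prime) [CharP G p]
    (hn : n + 1 = Fintype.card G) (hn1 : 1 < n) (hβ : IsPrimitiveRoot β n) :
    ∃ A : Submodule K (G → K), IsExtendedMaximalAffineInvariant n β A := by
  have : ExpChar G p := .prime hp
  have hg : minpoly K β ∣ X ^ n - 1 := minpoly.dvd K β (by simp [hβ.pow_eq_one])
  have hT := definingSet_minpoly (K := K) hβ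
  have h1 : p ^ 0 ∈ definingSet n β (minpoly K β) := by
    rw [hT]
    exact ⟨by simpa using hn1, 0, by simp [Nat.ModEq]⟩
  have h0 : 0 ∉ definingSet n β (minpoly K β) := by
    rw [hT]
    exact zero_notMem_cyclotomicClass (coprime_card_of_add_one_eq_card hn) hn1 one_ne_zero
  refine ⟨_, ⟨_, hg, ⟨1, hn1, hT⟩, rfl⟩, ?_⟩
  rw [extendedCode_eq_parityCode hp hn hβ (by omega) hg h0 h1]
  · exact isAffineInvariant_parityCode _
  · intro i hi
    rw [hT] at hi
    simpa using hi.2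

theorem IsExtendedMaximalAffineInvariant.exists_eq_parityCode (hp : p.Prime) [CharP G p]
    (hn : n + 1 = Fintype.card G) (hn1 : 1 < n) (hβ : IsPrimitiveRoot β n)
    {A : Submodule K (G → K)} (hA : IsExtendedMaximalAffineInvariant n β A) :
    ∃ e : G ≃ G, A = parityCode K e := by
  have : ExpChar G p := .prime hp
  obtain ⟨⟨g, hg, ⟨j, hj, hT⟩, rfl⟩, hinv⟩ := hA
  have hn0 : 0 < n := by omega
  by_cases hj0 : j = 0
  · subst hj0
    exact absurd hinv (not_isAffineInvariant_of_zero hn hβ hn1 hg hT)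
  obtain ⟨s, hs⟩ := exists_prime_pow_mem_cyclotomicClass hp hn hβ hg hj hj0 hT hinv
  have hqM := card_pow_finrank_modEq_one (K := K) hn
  have hclass : ∀ i ∈ definingSet n β g, ∃ l, i ≡ p ^ s * Fintype.card K ^ l [MOD n] := by
    intro i hi
    rw [hT] at hi hs
    obtain ⟨-, a, ha⟩ := hi
    obtain ⟨-, b, hb⟩ := hs
    obtain ⟨l, hl⟩ := exists_modEq_mul_pow hqM Module.finrank_pos.ne' hb
    refine ⟨l + a, ha.trans ?_⟩
    rw [pow_add, ← mul_assoc]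
    exact hl.mul_right _
  refine ⟨_, extendedCode_eq_parityCode hp hn hβ hn0 hg ?_ hs hclass⟩
  rw [hT]
  exact zero_notMem_cyclotomicClass (coprime_card_of_add_one_eq_card hn) hj hj0

end Main

end AffineCode

theorem mainTheorem3 (p r m : ℕ) (hp : p.Prime) (hr : 0 < r) (hm : 0 < m) (hrm : r ∣ m)
    (h : 3 < p ∨ 2 < m ∨ r ≠ 1)
    {K G : Type*} [Field K] [Fintype K] [DecidableEq K] [Field G] [Fintype G] [DecidableEq G]
    [Algebra K G] (hK : Fintype.card K = p ^ r) (hG : Fintype.card G = p ^ m)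
    (β : G) (hβ : IsPrimitiveRoot β (p ^ m - 1)) :
    (∃ A : Submodule K (G → K), AffineCode.IsExtendedMaximalAffineInvariant (p ^ m - 1) β A) ∧
    ∀ A : Submodule K (G → K), AffineCode.IsExtendedMaximalAffineInvariant (p ^ m - 1) β A →
      AffineCode.dualCode A ≤ A ∧
      ∃ k dQ dA : ℕ,
        k + (2 + 2 * (m / r)) = p ^ m ∧
        AffineCode.HasMinDist A dA ∧
        AffineCode.IsQuantumCode (AffineCode.cssCode A A) k dQ ∧
        dA ≤ dQ ∧ dQ ≤ m / r + 2 := by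
  have : Fact p.Prime := ⟨hp⟩
  have : CharP G p := charP_of_card_eq_prime_pow hG
  obtain ⟨M, rfl⟩ := hrm
  have hMr : r * M / r = M := Nat.mul_div_cancel_left M hr
  have hM : Module.finrank K G = M := by
    have h1 := Module.card_eq_pow_finrank (K := K) (V := G)
    rw [hG, hK, ← pow_mul] at h1
    exact (Nat.eq_of_mul_eq_mul_left hr (Nat.pow_right_injective hp.two_le h1)).symm
  have hM0 : 0 < M := Nat.pos_of_mul_pos_left hm
  -- The degree bound making A^⊥ ⊆ A: for r = 1, either p - 1 > 2 or M = m > 2; for r > 1, q ≥ 4.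
  have hqM : 2 < (p ^ r - 1) * M := by
    have h2 := hp.two_le
    have hpr : p ≤ p ^ r := Nat.le_self_pow hr.ne' p
    rcases eq_or_ne r 1 with rfl | hr1
    · rw [pow_one]
      rw [one_mul] at h
      rcases h with h | h | h
      · exact Nat.lt_of_lt_of_le (by omega) (Nat.le_mul_of_pos_right (p - 1) hM0)
      · exact h.trans_le (Nat.le_mul_of_pos_left M (by omega))
      · exact absurd rfl h
    · have h4 : 2 ^ 2 ≤ p ^ r := (Nat.pow_le_pow_left h2 2).trans
        (Nat.pow_le_pow_right hp.pos (by omega))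
      exact Nat.lt_of_lt_of_le (by omega) (Nat.le_mul_of_pos_right (p ^ r - 1) hM0)
  -- By Bernoulli, p^m ≥ 1 + M(q - 1) > 3.
  have hn1 : 1 < p ^ (r * M) - 1 := by
    have h1 := one_add_le_pow_of_two_add_nonneg (Nat.zero_le (2 + (p ^ r - 1))) M
    rw [Nat.add_sub_of_le (Nat.one_le_pow _ _ hp.pos), ← pow_mul, Nat.cast_id, mul_comm M] at h1
    omega
  have hn : p ^ (r * M) - 1 + 1 = Fintype.card G := by omega
  refine ⟨AffineCode.exists_isExtendedMaximalAffineInvariant hp hn hn1 hβ, fun A hA => ?_⟩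
  obtain ⟨e, rfl⟩ := hA.exists_eq_parityCode hp hn hn1 hβ
  have hle := AffineCode.affineWords_le_parityCode K e (by rwa [hK, hM])
  have hdual : AffineCode.dualCode (AffineCode.parityCode K e) ≤ AffineCode.parityCode K e := by
    rwa [AffineCode.dualCode_parityCode]
  have hw := AffineCode.exists_mem_parityCode_hammingNorm_le K e hle
  rw [← AffineCode.dualCode_parityCode, hM] at hw
  obtain ⟨dA, hdA⟩ := AffineCode.exists_hasMinDist (A := AffineCode.parityCode K e) (by
    obtain ⟨w, hw, hw0, -⟩ := hw
    exact (Submodule.ne_bot_iff _).2 ⟨w, hw, hw0⟩)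
  obtain ⟨dQ, hQ, h1, h2⟩ := AffineCode.isQuantumCode_cssCode hdual hdA hw
  refine ⟨hdual, _, dQ, dA, ?_, hdA, hQ, h1, by rwa [hMr]⟩
  have hr1 := AffineCode.finrank_parityCode K e
  have hr2 := Submodule.finrank_mono hle
  rw [AffineCode.finrank_affineWords] at hr2
  rw [AffineCode.dualCode_parityCode, AffineCode.finrank_affineWords, hMr]
  omega
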